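/- **Setting.** Let $\beta\in\mathbb C$, $\beta\neq 0$, and fix square roots $\sqrt\beta$ and $\sqrt{-2}$; put $\sqrt{-2\beta}:=\sqrt{-2}\,\sqrt\beta$. Let $\mathcal H$ be the Heisenberg algebra generated by $a_n,\widetilde a_n$ ($n\in\mathbb Z$), $\chi,\widetilde\chi$ with $[a_n,a_m]=[\widetilde a_n,\widetilde a_m]=n\delta_{n+m,0}$, $[a_n,\chi]=[\widetilde a_n,\widetilde\chi]=\delta_{n,0}$ and all other commutators zero. It acts on the Neveu–Schwarz Fock space $\mathcal F=\bigoplus_{n\in\mathbb Z,\,p\in\mathbb C}\mathbb C[a_{-1},a_{-2},\dots,\widetilde a_{-1},\widetilde a_{-2},\dots]\,|n,p\rangle$, where $a_0|n,p\rangle=n|n,p\rangle$, $\widetilde a_0|n,p\rangle=p|n,p\rangle$, $a_k|n,p\rangle=\widetilde a_k|n,p\rangle=0$ for $k>0$, and $e^{\pm\chi}|n,p\rangle=|n\pm1,p\rangle$. Normal ordering $:\ :$ puts $a_k,\widetilde a_k$ with $k\ge 0$ to the right of $a_{-k},\widetilde a_{-k}$ ($k>0$), $\chi$ and $\widetilde\chi$.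 Put $\phi(z)=\chi+a_0\log z-\sum_{n\ne0}\frac1n a_nz^{-n}$, $\widetilde\phi'(z)=\sum_{n\in\mathbb Z}\widetilde a_nz^{-n-1}$, $$\psi(z)=\tfrac1{\sqrt{-2}}\bigl(:e^{\phi(z)}:-:e^{-\phi(z)}:\bigr),\qquad \widetilde\psi(z)=\tfrac1{\sqrt2}\bigl(:e^{\phi(z)}:+:e^{-\phi(z)}:\bigr),$$ and let $$G(z)=\widetilde\phi'(z)\,\psi(z)+2\sigma\,\psi'(z),\qquad \sigma=\frac{1-\beta}{2\sqrt\beta},$$ be the bosonized Kato–Matsuda realization of the $N=1$ super-Virasoro supercurrent. For $\hbar\in\mathbb C$ set $q_1=e^{\hbar}$, $q_2=e^{(\beta-1)\hbar}$, $q_3=e^{-\beta\hbar}$, $q=e^{(\beta-1)\hbar/2}$ (so $q_2=q^2$). With $\epsilon_1=1$, $\epsilon_2=-1$ define, for $i=1,2$ and $n>0$, $$\lambda_{i,n}=\epsilon_i\frac{(1+q_1^n)(1+q_3^n)}{2(1+q_2^{-n})}a_n+\frac{\sqrt\beta}2(1-q_1^n)\widetilde a_n,\qquad \lambda_{i,-n}=\epsilon_i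 a_{-n}+\frac{1-q_3^n}{\sqrt\beta\,(1+q_2^{-n})}\widetilde a_{-n},$$ together with $\lambda_{i,0}=\epsilon_i a_0$, $\chi_i=\epsilon_i\chi$, $\mathsf a=\frac{\sqrt\beta}2\widetilde a_0$, and put $W_i(z)=\Lambda_i^+(z)+\Lambda_i^-(z)$, where $$\Lambda_i^{+}(z)=\,:\exp\Bigl(-\sum_{n\ne0}\frac{q^{n}}n\lambda_{i,n}z^{-n}\Bigr):\,e^{\chi_i}(q^{-1}z)^{\lambda_{i,0}}q_1^{\mathsf a},\qquad \Lambda_i^{-}(z)=\,:\exp\Bigl(\sum_{n\ne0}\frac{q^{-n}}n\lambda_{i,n}z^{-n}\Bigr):\,e^{-\chi_i}(qz)^{-\lambda_{i,0}}q_1^{-\mathsf a},$$ and $q_1^{\pm\mathsf a}$ means $e^{\pm\hbar\mathsf a}$. **Theorem.** As $\hbar\to0$ with $\beta$ fixed, the $\hbar$-expansions of $W_i(z)$ are $$W_1(z)=\sqrt2\,\widetilde\psi(z)+\frac{\sqrt{-2\beta}}2\,G(z)\,z\,\hbar+O(\hbar^2),\qquad W_2(z)=\sqrt2\,\widetilde\psi(z)-\frac{\sqrt{-2\beta}}2\,G(z)\,z\,\hbar+O(\hbar^2).$$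 That is: for every $m\in\mathbb Z$ and $v\in\mathcal F$, the coefficient of $z^m$ in $W_i(z)v$, as a function of $\hbar$, takes values in a finite-dimensional subspace of $\mathcal F$, is analytic at $\hbar=0$, and has the constant and linear Taylor coefficients given by these formulas. -/

import Mathlib

open scoped Topology

noncomputable section

namespace QSuperVir

/-- The Fock space of the Heisenberg algebra generated by `a_n, χ, ã_n, χ̃` in the
Neveu-Schwarz sector.  The label `(n, p) : ℤ × ℂ` is the highest weight vector on which
`a_0` acts by `n` and `ã_0` acts by `p`; the polynomial variable `X (inl k)` is `a_{-(k+1)}` and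
`X (inr k)` is `ã_{-(k+1)}`. -/
abbrev Fock : Type := (ℤ × ℂ) →₀ MvPolynomial (ℕ ⊕ ℕ) ℂ

/-- Linear operators on the Fock space. -/
abbrev Op : Type := Module.End ℂ Fock

/-- An operator on polynomials, acting on every summand of the Fock space. -/
def onPoly (L : Module.End ℂ (MvPolynomial (ℕ ⊕ ℕ) ℂ)) : Op :=
  Finsupp.mapRange.linearMap L

/-- The operator acting on the summand labelled `s` as the scalar `f s`. -/
def diag (f : ℤ × ℂ → ℂ) : Op :=
  Finsupp.lsum ℂ (fun s => f s • Finsupp.lsingle s)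

/-- The modes of one free boson: for `n > 0` the mode `-n` is multiplication by its variable, the
mode `n` is `n ∂/∂(variable)`, and the mode `0` is diagonal. -/
def bosonMode (zero : ℤ × ℂ → ℂ) (var : ℕ → ℕ ⊕ ℕ) : ℤ → Op
  | Int.ofNat 0 => diag zero
  | Int.ofNat (k + 1) =>
      ((k : ℂ) + 1) • onPoly (MvPolynomial.pderiv (R := ℂ) (var k)).toLinearMap
  | Int.negSucc k => onPoly (LinearMap.mulLeft ℂ (MvPolynomial.X (var k)))

/-- The boson modes `a_n`. -/
def a : ℤ → Op := bosonMode (fun s => (s.1 : ℂ)) Sum.inl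

/-- The boson modes `ã_n`. -/
def aT : ℤ → Op := bosonMode (fun s => s.2) Sum.inr

/-- The operator `e^{k χ}`, where `[a_0, χ] = 1`. -/
def expChi (k : ℤ) : Op :=
  Finsupp.lmapDomain _ ℂ (fun s : ℤ × ℂ => (s.1 + k, s.2))

/-- The operator `e^{t ã_0}`. -/
def expAT0 (t : ℂ) : Op := diag (fun s => Complex.exp (t * s.2))

/-- Formal operator-valued series `A(z) = ∑_m A_m z^m`, infinite in both directions;
`A m v` is the coefficient of `z^m` in `A(z) v`. -/
abbrev OpSeries : Type := ℤ → Fock → Fock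

/-- The product `A(z) B(z)`, used where on every vector each coefficient is a finite sum. -/
def OpSeries.prod (A B : OpSeries) : OpSeries :=
  fun m v => ∑ᶠ k : ℤ, A (m - k) (B k v)

/-- The derivative of `A(z)` with respect to `z`. -/
def OpSeries.deriv (A : OpSeries) : OpSeries :=
  fun m v => ((m : ℂ) + 1) • A (m + 1) v

/-- The series `z A(z)`. -/
def OpSeries.mulZ (A : OpSeries) : OpSeries :=
  fun m v => A (m - 1) v

/-- `exp f = ∑_k f^k / k!` for a power series `f` without constant term (then `f^k` contributes
to the coefficient of degree `m` only when `k ≤ m`). -/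
def opExp (f : PowerSeries Op) : PowerSeries Op :=
  PowerSeries.mk fun m =>
    ∑ k ∈ Finset.range (m + 1), ((k.factorial : ℂ)⁻¹) • PowerSeries.coeff m (f ^ k)

/-- `exp (∑_{n>0} x_{-n} z^n)`. -/
def creationExp (x : ℤ → Op) : OpSeries := fun m v =>
  if 0 ≤ m then
    PowerSeries.coeff m.toNat
      (opExp (PowerSeries.mk fun n => if n = 0 then 0 else x (-(n : ℤ)))) v
  else 0

/-- `exp (∑_{n>0} x_n z^{-n})`. -/
def annihilationExp (x : ℤ → Op) : OpSeries := fun m v =>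
  if m ≤ 0 then
    PowerSeries.coeff (-m).toNat
      (opExp (PowerSeries.mk fun n => if n = 0 then 0 else x (n : ℤ))) v
  else 0

/-- The normal ordered exponential `:exp (∑_{n≠0} x_n z^{-n}):`. -/
def normalExp (x : ℤ → Op) : OpSeries :=
  (creationExp x).prod (annihilationExp x)

/-- The series `(c z)^{k a_0}`. -/
def powA0 (c : ℂ) (k : ℤ) (m : ℤ) : Op :=
  diag (fun s => if k * s.1 = m then c ^ m else 0)

/-- The vertex operator `:e^{k φ(z)}:` with `φ(z) = χ + a_0 log z - ∑_{n≠0} a_n z^{-n} / n`. -/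
def vertexPhi (k : ℤ) : OpSeries :=
  (normalExp fun n => (-((k : ℂ) / n)) • a n).prod
    (fun m v => expChi k (powA0 1 k m v))

/-- The fermion `ψ(z) = (1/√-2) (:e^{φ(z)}: - :e^{-φ(z)}:)`, with `s` the chosen root `√-2`. -/
def psi (s : ℂ) : OpSeries := s⁻¹ • (vertexPhi 1 - vertexPhi (-1))

/-- The fermion `ψ̃(z) = (1/√2) (:e^{φ(z)}: + :e^{-φ(z)}:)`. -/
def psiT : OpSeries := ((Real.sqrt 2 : ℝ) : ℂ)⁻¹ • (vertexPhi 1 + vertexPhi (-1))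

/-- `φ̃'(z) = ∑_n ã_n z^{-n-1}`. -/
def dPhiT : OpSeries := fun m v => aT (-m - 1) v

/-- The supercurrent `G(z) = φ̃'(z) ψ(z) + 2 σ ψ'(z)`. -/
def G (s σ : ℂ) : OpSeries := dPhiT.prod (psi s) + (2 * σ) • (psi s).deriv

/-! The parameters, as functions of `ħ`; here `q₂ = q ^ 2` and `q₁ q₂ q₃ = 1`. -/

def q1 (ħ : ℂ) : ℂ := Complex.exp ħ
def q2 (β ħ : ℂ) : ℂ := Complex.exp ((β - 1) * ħ)
def q3 (β ħ : ℂ) : ℂ := Complex.exp (-β * ħ)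
def q (β ħ : ℂ) : ℂ := Complex.exp ((β - 1) * ħ / 2)

/-- The sign `+1` for the first index and `-1` for the second. -/
def sgn : Fin 2 → ℤ := ![1, -1]

/-- The deformed boson modes `λ_{i,n}` realized in terms of `a_n` and `ã_n`, with `b` the chosen
root `√β`; the index `i = 0, 1` stands for `1, 2`. -/
def lam (β b ħ : ℂ) (i : Fin 2) (n : ℤ) : Op :=
  if 0 < n then
    ((sgn i : ℂ) * ((1 + q1 ħ ^ n) * (1 + q3 β ħ ^ n) / (2 * (1 + q2 β ħ ^ (-n))))) • a n
      + (b / 2 * (1 - q1 ħ ^ n)) • aT n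
  else if n < 0 then
    (sgn i : ℂ) • a n + ((1 - q3 β ħ ^ (-n)) / (b * (1 + q2 β ħ ^ n))) • aT n
  else (sgn i : ℂ) • a 0

/-- `Λ_i^+(z) = :exp(-∑_{n≠0} (q^n/n) λ_{i,n} z^{-n}): e^{χ_i} (q⁻¹ z)^{λ_{i,0}} q₁^{𝖺}`, where
`χ_i = ± χ`, `λ_{i,0} = ± a_0` and `𝖺 = (√β / 2) ã_0`. -/
def LambdaPlus (β b ħ : ℂ) (i : Fin 2) : OpSeries :=
  (normalExp fun n => (-(q β ħ ^ n / (n : ℂ))) • lam β b ħ i n).prod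
    (fun m v => expChi (sgn i) (powA0 (q β ħ)⁻¹ (sgn i) m (expAT0 (ħ * (b / 2)) v)))

/-- `Λ_i^-(z) = :exp(∑_{n≠0} (q^{-n}/n) λ_{i,n} z^{-n}): e^{-χ_i} (q z)^{-λ_{i,0}} q₁^{-𝖺}`. -/
def LambdaMinus (β b ħ : ℂ) (i : Fin 2) : OpSeries :=
  (normalExp fun n => (q β ħ ^ (-n) / (n : ℂ)) • lam β b ħ i n).prod
    (fun m v => expChi (-sgn i) (powA0 (q β ħ) (-sgn i) m (expAT0 (-(ħ * (b / 2))) v)))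

/-- `W_i(z) = Λ_i^+(z) + Λ_i^-(z)`. -/
def W (β b ħ : ℂ) (i : Fin 2) : OpSeries := LambdaPlus β b ħ i + LambdaMinus β b ħ i

/-- `f(ħ) = c₀ + c₁ ħ + O(ħ²)` for a Fock space valued function: `f` takes its values in a
finite-dimensional subspace, is analytic at `ħ = 0`, and has the given expansion there. -/
def HasFirstOrderExpansion (f : ℂ → Fock) (c₀ c₁ : Fock) : Prop :=
  (∃ V : Submodule ℂ Fock, FiniteDimensional ℂ V ∧ ∀ ħ, f ħ ∈ V) ∧
    ∀ l : Fock →ₗ[ℂ] ℂ,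
      AnalyticAt ℂ (fun ħ => l (f ħ)) 0 ∧
        (fun ħ => l (f ħ - c₀ - ħ • c₁)) =O[𝓝 0] (fun ħ : ℂ => ħ ^ 2)

/-- `A(z; ħ) = A₀(z) + A₁(z) ħ + O(ħ²)`: the expansion holds for every coefficient in `z`,
applied to every vector. -/
def SeriesExpansion (A : ℂ → OpSeries) (A₀ A₁ : OpSeries) : Prop :=
  ∀ (m : ℤ) (v : Fock), HasFirstOrderExpansion (fun ħ => A ħ m v) (A₀ m v) (A₁ m v)

end QSuperVir

end

/-! To first order, every mode of the deformed boson is `λ_{i,n} = ε_i a_n - ħ (n√β/2) ã_n + O(ħ²)`,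
for positive and negative `n` alike. After multiplication by `∓1/n` the `ã_n`-coefficient is
`±√β/2`, independent of `n`. Together with the zero mode supplied by `q₁^{±𝖺}`, the linear part of
the exponent is therefore `±ħ(√β/2) z φ̃'(z)`. The factors `q^{±n}` and `(q^{∓1}z)^{±λ_{i,0}}`
together substitute `q^{∓1}z` for `z`, which adds `±ħ((1-β)/2) z d/dz`. Hence `Λ_i^±` is `(1 ±
ħ((√β/2) zφ̃' + ((1-β)/2) z d/dz)) :e^{±ε_iφ}:` up to `O(ħ²)`, and adding the two signs gives `ψ̃`
and `G`.

Rigour comes from finiteness. On a fixed vector each coefficient is a sum over an index set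
independent of `ħ` (`vertex_apply`), because annihilation modes lower the weight. Jets can then be
computed termwise by the product rule (`OpJet.mul`) and by the derivative `f₁ exp f₀` of an
exponential (`SeriesJet.exp`), valid because `a` and `ã` commute. `Jet.vertex` collects the result
and `lam_jet` supplies the modes. -/

noncomputable section

namespace QSuperVir

/-! ### First-order jets of vector valued functions -/

section Jet

variable {E : Type*} [AddCommGroup E] [Module ℂ E]

/-- `f` is a finite sum of fixed vectors with coefficients analytic at `0`, and `c₀`, `c₁` are its
Taylor coefficients of degree `0` and `1`. -/
inductive Jet : (ℂ → E) → E → E → Prop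
  | smul_const (g : ℂ → ℂ) (e : E) (hg : AnalyticAt ℂ g 0) :
      Jet (fun ħ => g ħ • e) (g 0 • e) (deriv g 0 • e)
  | add {f f' : ℂ → E} {c₀ c₁ c₀' c₁' : E} : Jet f c₀ c₁ → Jet f' c₀' c₁' →
      Jet (fun ħ => f ħ + f' ħ) (c₀ + c₀') (c₁ + c₁')

theorem Jet.of_eq {f f' : ℂ → E} {c₀ c₁ c₀' c₁' : E} (h : Jet f c₀ c₁) (hf : ∀ ħ, f' ħ = f ħ)
    (h₀ : c₀' = c₀) (h₁ : c₁' = c₁) : Jet f' c₀' c₁' := by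
  obtain rfl : f' = f := funext hf
  rw [h₀, h₁]
  exact h

theorem Jet.const (e : E) : Jet (fun _ => e) e 0 :=
  (Jet.smul_const (fun _ => 1) e analyticAt_const).of_eq (by simp) (by simp) (by simp)

theorem Jet.sum {ι : Type*} (S : Finset ι) {f : ι → ℂ → E} {c₀ c₁ : ι → E}
    (h : ∀ i ∈ S, Jet (f i) (c₀ i) (c₁ i)) :
    Jet (fun ħ => ∑ i ∈ S, f i ħ) (∑ i ∈ S, c₀ i) (∑ i ∈ S, c₁ i) := by
  classical
  induction S using Finset.induction_on with
  | empty => exact Jet.const (0 : E)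
  | insert i S hi ih =>
    simp only [Finset.sum_insert hi]
    exact (h i (by simp)).add (ih fun j hj => h j (by simp [hj]))

theorem Jet.smul {g : ℂ → ℂ} (hg : AnalyticAt ℂ g 0) {f : ℂ → E} {c₀ c₁ : E} (h : Jet f c₀ c₁) :
    Jet (fun ħ => g ħ • f ħ) (g 0 • c₀) (g 0 • c₁ + deriv g 0 • c₀) := by
  induction h with
  | smul_const k e hk =>
    refine (Jet.smul_const (fun ħ => g ħ * k ħ) e (hg.mul hk)).of_eq ?_ ?_ ?_
    · intro ħ; rw [mul_smul]
    · rw [mul_smul]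
    · rw [deriv_fun_mul hg.differentiableAt hk.differentiableAt]
      module
  | add _ _ ih ih' =>
    refine (ih.add ih').of_eq ?_ ?_ ?_
    · intro ħ; rw [smul_add]
    · rw [smul_add]
    · module

theorem isBigO_taylor_two {g : ℂ → ℂ} (hg : AnalyticAt ℂ g 0) :
    (fun ħ => g ħ - g 0 - ħ * deriv g 0) =O[𝓝 0] (fun ħ : ℂ => ħ ^ 2) := by
  obtain ⟨p, hp⟩ := hg
  have h := hp.isBigO_sub_partialSum_pow 2
  have h0 : p 0 (fun _ => 0) = g 0 := hp.coeff_zero _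
  refine (h.congr_left fun ħ => ?_).trans
    (Asymptotics.isBigO_of_le _ fun ħ => by simp)
  -- The degree-one term is linear in `ħ`, and its value at `1` is the derivative.
  have h1 : p 1 (fun _ => ħ) = ħ * deriv g 0 := by
    rw [hp.deriv]
    have := (p 1).map_smul_univ (fun _ => ħ) (fun _ => (1 : ℂ))
    simpa only [smul_eq_mul, mul_one, Finset.prod_const, Finset.card_univ, Fintype.card_fin,
      pow_one] using this
  have h0' : p 0 (fun _ => ħ) = g 0 := hp.coeff_zero _
  simp only [FormalMultilinearSeries.partialSum, Finset.sum_range_succ, Finset.sum_range_zero,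
    zero_add, h1, h0']
  ring

theorem Jet.hasFirstOrderExpansion {f : ℂ → Fock} {c₀ c₁ : Fock} (h : Jet f c₀ c₁) :
    HasFirstOrderExpansion f c₀ c₁ := by
  induction h with
  | smul_const g e hg =>
    refine ⟨⟨Submodule.span ℂ {e}, inferInstance, fun ħ =>
      Submodule.smul_mem _ _ (Submodule.mem_span_singleton_self e)⟩, fun l => ⟨?_, ?_⟩⟩
    · simp only [map_smul, smul_eq_mul]
      exact hg.mul analyticAt_const
    · refine ((isBigO_taylor_two hg).mul (Asymptotics.isBigO_const_const (l e) one_ne_zero _)).congr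
        (fun ħ => ?_) (fun ħ => mul_one _)
      simp only [map_sub, map_smul, smul_eq_mul]
      ring
  | add _ _ ih ih' =>
    obtain ⟨⟨V, hV, hf⟩, hl⟩ := ih
    obtain ⟨⟨V', hV', hf'⟩, hl'⟩ := ih'
    refine ⟨⟨V ⊔ V', inferInstance, fun ħ => Submodule.add_mem_sup (hf ħ) (hf' ħ)⟩,
      fun l => ⟨?_, ?_⟩⟩
    · simp only [map_add]
      exact (hl l).1.add (hl' l).1
    · refine ((hl l).2.add (hl' l).2).congr_left fun ħ => ?_
      rw [← map_add]
      congr 1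
      module

/-- `A₀ + A₁ ħ` is the first-order jet of the family of operators `A`, on every vector. -/
def OpJet (A : ℂ → Module.End ℂ E) (A₀ A₁ : Module.End ℂ E) : Prop :=
  ∀ v, Jet (fun ħ => A ħ v) (A₀ v) (A₁ v)

/-- The product rule needs no topology on `E`: on a term `g(ħ) e`, linearity moves `g` outside and
leaves `A` acting on a fixed vector. -/
theorem OpJet.apply {A : ℂ → Module.End ℂ E} {A₀ A₁ : Module.End ℂ E} (hA : OpJet A A₀ A₁)
    {f : ℂ → E} {c₀ c₁ : E} (hf : Jet f c₀ c₁) :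
    Jet (fun ħ => A ħ (f ħ)) (A₀ c₀) (A₀ c₁ + A₁ c₀) := by
  induction hf with
  | smul_const g e hg =>
    refine ((hA e).smul hg).of_eq ?_ ?_ ?_
    · intro ħ; rw [map_smul]
    · rw [map_smul]
    · rw [map_smul, map_smul, add_comm]
  | add _ _ ih ih' =>
    refine (ih.add ih').of_eq ?_ ?_ ?_
    · intro ħ; rw [map_add]
    · rw [map_add]
    · simp only [map_add]; abel

theorem OpJet.of_eq {A A' : ℂ → Module.End ℂ E} {A₀ A₁ A₀' A₁' : Module.End ℂ E}
    (h : OpJet A A₀ A₁) (hA : ∀ ħ, A' ħ = A ħ) (h₀ : A₀' = A₀) (h₁ : A₁' = A₁) :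
    OpJet A' A₀' A₁' := by
  obtain rfl : A' = A := funext hA
  rw [h₀, h₁]
  exact h

theorem OpJet.const (A : Module.End ℂ E) : OpJet (fun _ => A) A 0 := fun v => Jet.const (A v)

theorem OpJet.add {A B : ℂ → Module.End ℂ E} {A₀ A₁ B₀ B₁ : Module.End ℂ E}
    (hA : OpJet A A₀ A₁) (hB : OpJet B B₀ B₁) :
    OpJet (fun ħ => A ħ + B ħ) (A₀ + B₀) (A₁ + B₁) := fun v => (hA v).add (hB v)

theorem OpJet.smul {g : ℂ → ℂ} (hg : AnalyticAt ℂ g 0) {A : ℂ → Module.End ℂ E}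
    {A₀ A₁ : Module.End ℂ E} (hA : OpJet A A₀ A₁) :
    OpJet (fun ħ => g ħ • A ħ) (g 0 • A₀) (g 0 • A₁ + deriv g 0 • A₀) :=
  fun v => (hA v).smul hg

theorem OpJet.sum {ι : Type*} (S : Finset ι) {A : ι → ℂ → Module.End ℂ E}
    {A₀ A₁ : ι → Module.End ℂ E} (h : ∀ i ∈ S, OpJet (A i) (A₀ i) (A₁ i)) :
    OpJet (fun ħ => ∑ i ∈ S, A i ħ) (∑ i ∈ S, A₀ i) (∑ i ∈ S, A₁ i) := fun v =>
  (Jet.sum S fun i hi => h i hi v).of_eq (fun ħ => by simp) (by simp) (by simp)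

theorem OpJet.mul {A B : ℂ → Module.End ℂ E} {A₀ A₁ B₀ B₁ : Module.End ℂ E}
    (hA : OpJet A A₀ A₁) (hB : OpJet B B₀ B₁) :
    OpJet (fun ħ => A ħ * B ħ) (A₀ * B₀) (A₀ * B₁ + A₁ * B₀) := fun v => hA.apply (hB v)

end Jet

/-! ### Power series of operators -/

/-- The coefficientwise first-order jet of a family of power series of operators. -/
def SeriesJet (f : ℂ → PowerSeries Op) (f₀ f₁ : PowerSeries Op) : Prop :=
  ∀ n, OpJet (fun ħ => PowerSeries.coeff n (f ħ)) (PowerSeries.coeff n f₀) (PowerSeries.coeff n f₁)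

theorem SeriesJet.mul {f g : ℂ → PowerSeries Op} {f₀ f₁ g₀ g₁ : PowerSeries Op}
    (hf : SeriesJet f f₀ f₁) (hg : SeriesJet g g₀ g₁) :
    SeriesJet (fun ħ => f ħ * g ħ) (f₀ * g₀) (f₀ * g₁ + f₁ * g₀) := fun n =>
  (OpJet.sum (Finset.HasAntidiagonal.antidiagonal n) fun p _ => (hf p.1).mul (hg p.2)).of_eq
    (fun ħ => PowerSeries.coeff_mul n _ _) (PowerSeries.coeff_mul n _ _)
    (by rw [map_add, PowerSeries.coeff_mul, PowerSeries.coeff_mul, Finset.sum_add_distrib])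

/-- Commutation collects the Leibniz terms `f₀^i f₁ f₀^j` into one. At `k = 0` the truncated
exponent `k - 1` is harmless because the factor `k` vanishes. -/
theorem SeriesJet.pow {f : ℂ → PowerSeries Op} {f₀ f₁ : PowerSeries Op}
    (hf : SeriesJet f f₀ f₁) (hc : Commute f₀ f₁) (k : ℕ) :
    SeriesJet (fun ħ => f ħ ^ k) (f₀ ^ k) (k • (f₁ * f₀ ^ (k - 1))) := by
  induction k with
  | zero =>
    refine fun n => (OpJet.const (PowerSeries.coeff n 1)).of_eq (fun _ => ?_) ?_ ?_
    · simp only [pow_zero]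
    · rw [pow_zero]
    · rw [zero_nsmul, map_zero]
  | succ k ih =>
    have h := ih.mul hf
    refine fun n => (h n).of_eq (fun _ => by simp only [pow_succ]) (by rw [pow_succ]) ?_
    congr 1
    rw [Nat.add_sub_cancel, (hc.pow_left k).eq, smul_mul_assoc, mul_assoc]
    rcases k with _ | k
    · simp
    · rw [Nat.add_sub_cancel, ← pow_succ, succ_nsmul' _ (k + 1)]

theorem coeff_pow_eq_zero {f : PowerSeries Op} (hf : PowerSeries.coeff 0 f = 0) {k n : ℕ}
    (h : n < k) : PowerSeries.coeff n (f ^ k) = 0 := by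
  induction k generalizing n with
  | zero => omega
  | succ k ih =>
    rw [pow_succ, PowerSeries.coeff_mul]
    refine Finset.sum_eq_zero fun p hp => ?_
    rw [Finset.HasAntidiagonal.mem_antidiagonal] at hp
    rcases Nat.eq_zero_or_pos p.2 with h2 | h2
    · rw [h2, hf, mul_zero]
    · rw [ih (by omega), zero_mul]

/-- Powers beyond the `m`-th do not reach degree `m`, so coefficients of different degrees can share
one truncation bound. -/
theorem coeff_opExp {f : PowerSeries Op} (hf : PowerSeries.coeff 0 f = 0) {m N : ℕ} (h : m ≤ N) :
    PowerSeries.coeff m (opExp f) =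
      ∑ k ∈ Finset.range (N + 1), ((k.factorial : ℂ)⁻¹) • PowerSeries.coeff m (f ^ k) := by
  rw [opExp, PowerSeries.coeff_mk]
  refine Finset.sum_subset (by intro; simp; omega) fun k _ hk => ?_
  rw [coeff_pow_eq_zero hf (by simpa using hk), smul_zero]

theorem SeriesJet.exp {f : ℂ → PowerSeries Op} {f₀ f₁ : PowerSeries Op}
    (hf : SeriesJet f f₀ f₁) (hc : Commute f₀ f₁) (h₀ : PowerSeries.coeff 0 f₀ = 0)
    (h₁ : PowerSeries.coeff 0 f₁ = 0) :
    SeriesJet (fun ħ => opExp (f ħ)) (opExp f₀) (f₁ * opExp f₀) := by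
  intro m
  have h := OpJet.sum (Finset.range (m + 1)) fun k _ =>
    (hf.pow hc k m).smul (g := fun _ => ((k.factorial : ℂ)⁻¹)) analyticAt_const
  refine h.of_eq (fun ħ => by simp only [opExp, PowerSeries.coeff_mk])
    (by simp only [opExp, PowerSeries.coeff_mk]) ?_
  have hexp : PowerSeries.coeff m (f₁ * opExp f₀) =
      ∑ k ∈ Finset.range (m + 1), ((k.factorial : ℂ)⁻¹) • PowerSeries.coeff m (f₁ * f₀ ^ k) := by
    simp only [PowerSeries.coeff_mul, Finset.smul_sum]
    rw [Finset.sum_comm]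
    refine Finset.sum_congr rfl fun p hp => ?_
    rw [coeff_opExp h₀ (N := m) (by rw [Finset.HasAntidiagonal.mem_antidiagonal] at hp; omega), Finset.mul_sum]
    simp
  -- Differentiation lowers the power of `f₀` by one, so the differentiated sum stops at `f₀ ^ (m -
  -- 1)`. The surplus top term vanishes because `f₁ f₀ ^ m` starts in degree `m + 1`.
  have hlast : PowerSeries.coeff m (f₁ * f₀ ^ m) = 0 := by
    rw [PowerSeries.coeff_mul]
    refine Finset.sum_eq_zero fun p hp => ?_
    rw [Finset.HasAntidiagonal.mem_antidiagonal] at hp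
    rcases Nat.eq_zero_or_pos p.1 with h2 | h2
    · rw [h2, h₁, zero_mul]
    · rw [coeff_pow_eq_zero h₀ (by omega), mul_zero]
  rw [hexp, Finset.sum_range_succ, hlast, smul_zero, add_zero, Finset.sum_range_succ']
  simp only [deriv_const', zero_smul, add_zero, map_zero, smul_zero, Nat.add_sub_cancel, map_nsmul]
  refine Finset.sum_congr rfl fun k _ => ?_
  rw [← Nat.cast_smul_eq_nsmul ℂ, smul_smul, Nat.factorial_succ]
  congr 1
  have : ((k : ℂ) + 1) ≠ 0 := Nat.cast_add_one_ne_zero k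
  push_cast
  field_simp

/-! ### Operators on the Fock space -/

theorem diag_apply (f : ℤ × ℂ → ℂ) (v : Fock) (s : ℤ × ℂ) : diag f v s = f s • v s := by
  induction v using Finsupp.induction_linear with
  | zero => simp
  | add v w hv hw => simp only [map_add, Finsupp.add_apply, hv, hw, smul_add]
  | single t p =>
    by_cases h : t = s
    · subst h; simp [diag]
    · simp [diag, Finsupp.single_eq_of_ne' h]

theorem onPoly_apply (L : Module.End ℂ (MvPolynomial (ℕ ⊕ ℕ) ℂ)) (v : Fock) (s : ℤ × ℂ) :
    onPoly L v s = L (v s) := rfl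

theorem expChi_apply (k : ℤ) (v : Fock) (s : ℤ × ℂ) : expChi k v s = v (s.1 - k, s.2) := by
  have hinj : Function.Injective (fun s : ℤ × ℂ => (s.1 + k, s.2)) := by
    rintro ⟨n, p⟩ ⟨n', p'⟩ h
    simpa using h
  have h := Finsupp.mapDomain_apply hinj v (s.1 - k, s.2)
  rw [sub_add_cancel] at h
  exact h

theorem expAT0_zero : expAT0 0 = 1 := by
  refine LinearMap.ext fun v => Finsupp.ext fun s => ?_
  simp [expAT0, diag_apply]

theorem powA0_apply (c : ℂ) (k m : ℤ) (v : Fock) : powA0 c k m v = c ^ m • powA0 1 k m v := by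
  refine Finsupp.ext fun s => ?_
  rw [Finsupp.smul_apply, powA0, powA0, diag_apply, diag_apply]
  split_ifs <;> simp

theorem commute_diag_onPoly (f : ℤ × ℂ → ℂ) (L : Module.End ℂ (MvPolynomial (ℕ ⊕ ℕ) ℂ)) :
    Commute (diag f) (onPoly L) := by
  refine LinearMap.ext fun v => Finsupp.ext fun s => ?_
  simp [diag_apply, onPoly_apply]

theorem commute_diag_diag (f g : ℤ × ℂ → ℂ) : Commute (diag f) (diag g) := by
  refine LinearMap.ext fun v => Finsupp.ext fun s => ?_
  simp only [Module.End.mul_apply, diag_apply]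
  exact smul_comm _ _ _

theorem commute_expChi_onPoly (k : ℤ) (L : Module.End ℂ (MvPolynomial (ℕ ⊕ ℕ) ℂ)) :
    Commute (expChi k) (onPoly L) := by
  refine LinearMap.ext fun v => Finsupp.ext fun s => ?_
  simp [expChi_apply, onPoly_apply]

theorem commute_onPoly {L M : Module.End ℂ (MvPolynomial (ℕ ⊕ ℕ) ℂ)} (h : Commute L M) :
    Commute (onPoly L) (onPoly M) := by
  refine LinearMap.ext fun v => Finsupp.ext fun s => ?_
  exact LinearMap.congr_fun h.eq (v s)

theorem commute_pderiv {i j : ℕ ⊕ ℕ} (hij : i ≠ j) :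
    Commute (MvPolynomial.pderiv (R := ℂ) i).toLinearMap
      (MvPolynomial.pderiv (R := ℂ) j).toLinearMap := by
  refine LinearMap.ext fun p => MvPolynomial.ext _ _ fun μ => ?_
  simp only [Module.End.mul_apply, Derivation.coeFn_coe,
    MvPolynomial.coeff_pderiv, Finsupp.add_apply, Finsupp.single_eq_of_ne hij,
    Finsupp.single_eq_of_ne' hij, add_right_comm μ]
  push_cast
  ring

theorem commute_pderiv_X {i j : ℕ ⊕ ℕ} (hij : i ≠ j) :
    Commute (MvPolynomial.pderiv (R := ℂ) i).toLinearMap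
      (LinearMap.mulLeft ℂ (MvPolynomial.X j)) := by
  refine LinearMap.ext fun p => ?_
  simp [MvPolynomial.pderiv_X_of_ne hij.symm]

theorem commute_X (i j : ℕ ⊕ ℕ) :
    Commute (LinearMap.mulLeft ℂ (MvPolynomial.X (R := ℂ) i))
      (LinearMap.mulLeft ℂ (MvPolynomial.X j)) := by
  refine LinearMap.ext fun p => ?_
  simp only [Module.End.mul_apply, LinearMap.mulLeft_apply]
  ring

/-- The two bosons act on disjoint sets of variables, and their zero modes are scalars on each
sector. -/
theorem commute_a_aT (n m : ℤ) : Commute (a n) (aT m) := by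
  have hne : ∀ i j : ℕ, (Sum.inl i : ℕ ⊕ ℕ) ≠ Sum.inr j := fun _ _ => Sum.inl_ne_inr
  rcases n with (_ | n) | n <;> rcases m with (_ | m) | m <;>
    simp only [a, aT, bosonMode]
  · exact commute_diag_diag _ _
  · exact (commute_diag_onPoly _ _).smul_right _
  · exact commute_diag_onPoly _ _
  · exact (commute_diag_onPoly _ _).symm.smul_left _
  · exact ((commute_onPoly (commute_pderiv (hne _ _))).smul_right _).smul_left _
  · exact (commute_onPoly (commute_pderiv_X (hne _ _))).smul_left _
  · exact (commute_diag_onPoly _ _).symm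
  · exact (commute_onPoly (commute_pderiv_X (hne _ _).symm).symm).smul_right _
  · exact commute_onPoly (commute_X _ _)

theorem commute_aT_diag (n : ℤ) (f : ℤ × ℂ → ℂ) : Commute (aT n) (diag f) := by
  rcases n with (_ | n) | n
  · exact commute_diag_diag _ _
  · exact (commute_diag_onPoly _ _).symm.smul_left _
  · exact (commute_diag_onPoly _ _).symm

theorem commute_aT_expChi (n k : ℤ) : Commute (aT n) (expChi k) := by
  rcases n with (_ | n) | n
  · refine LinearMap.ext fun v => Finsupp.ext fun s => ?_
    simp [aT, bosonMode, diag_apply, expChi_apply]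
  · exact (commute_expChi_onPoly _ _).symm.smul_left _
  · exact (commute_expChi_onPoly _ _).symm

/-! ### The grading by weight -/

/-- The weight of a monomial in the creation operators, where `a_{-n}` and `ã_{-n}` weigh `n`. -/
def monWeight : ((ℕ ⊕ ℕ) →₀ ℕ) →+ ℕ := Finsupp.weight (Sum.elim (· + 1) (· + 1))

/-- The vectors all of whose monomials have weight at most `e`. -/
def weightLE (e : ℤ) : Submodule ℂ Fock where
  carrier := {v | ∀ s μ, e < (monWeight μ : ℤ) → (v s).coeff μ = 0}
  add_mem' hv hw s μ h := by rw [Finsupp.add_apply, MvPolynomial.coeff_add, hv s μ h, hw s μ h,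
    add_zero]
  zero_mem' _ _ _ := by simp
  smul_mem' c v hv s μ h := by rw [Finsupp.smul_apply, MvPolynomial.coeff_smul, hv s μ h, smul_zero]

theorem exists_mem_weightLE (v : Fock) : ∃ e : ℕ, v ∈ weightLE e := by
  refine ⟨v.support.sup fun s => (v s).support.sup monWeight, fun s μ h => ?_⟩
  by_contra hμ
  have hs : s ∈ v.support := by
    rw [Finsupp.mem_support_iff]
    intro h0
    simp [h0] at hμ
  have h1 : monWeight μ ≤ (v s).support.sup monWeight :=
    Finset.le_sup (f := monWeight) (MvPolynomial.mem_support_iff.2 hμ)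
  have h2 := Finset.le_sup (f := fun s => (v s).support.sup monWeight) hs
  exact absurd h (not_lt.2 (by exact_mod_cast h1.trans h2))

theorem eq_zero_of_mem_weightLE {e : ℤ} (he : e < 0) {v : Fock} (hv : v ∈ weightLE e) : v = 0 :=
  Finsupp.ext fun s => MvPolynomial.ext _ _ fun μ => by
    rw [hv s μ (by omega), Finsupp.zero_apply, MvPolynomial.coeff_zero]

/-- The operator `A` lowers the weight by at least `n`. -/
def Lowers (n : ℤ) (A : Op) : Prop := ∀ e, ∀ v ∈ weightLE e, A v ∈ weightLE (e - n)

theorem Lowers.zero (n : ℤ) : Lowers n 0 := fun _ _ _ => Submodule.zero_mem _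

theorem Lowers.one : Lowers 0 1 := fun e v hv => by simpa using hv

theorem Lowers.smul {n : ℤ} {A : Op} (h : Lowers n A) (c : ℂ) : Lowers n (c • A) :=
  fun e v hv => Submodule.smul_mem _ c (h e v hv)

theorem Lowers.add {n : ℤ} {A B : Op} (hA : Lowers n A) (hB : Lowers n B) : Lowers n (A + B) :=
  fun e v hv => Submodule.add_mem _ (hA e v hv) (hB e v hv)

theorem Lowers.sum {ι : Type*} {n : ℤ} {S : Finset ι} {A : ι → Op} (h : ∀ i ∈ S, Lowers n (A i)) :
    Lowers n (∑ i ∈ S, A i) := fun e v hv => by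
  rw [LinearMap.sum_apply]
  exact Submodule.sum_mem _ fun i hi => h i hi e v hv

theorem Lowers.mul {n m l : ℤ} {A B : Op} (hA : Lowers n A) (hB : Lowers m B) (h : n + m = l) :
    Lowers l (A * B) := fun e v hv => by
  have := hA _ _ (hB e v hv)
  rwa [sub_sub, add_comm m, h] at this

theorem Lowers.diag (f : ℤ × ℂ → ℂ) : Lowers 0 (diag f) := fun e v hv s μ h => by
  rw [diag_apply, MvPolynomial.coeff_smul, hv s μ (by omega), smul_zero]

theorem Lowers.expChi (k : ℤ) : Lowers 0 (expChi k) := fun e v hv s μ h => by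
  rw [expChi_apply, hv _ μ (by omega)]

theorem Lowers.bosonMode (zero : ℤ × ℂ → ℂ) {var : ℕ → ℕ ⊕ ℕ}
    (hvar : ∀ k, monWeight (Finsupp.single (var k) 1) = k + 1) {n : ℤ} (hn : 0 < n) :
    Lowers n (bosonMode zero var n) := by
  rcases n with (_ | n) | n
  · exact absurd hn (by simp)
  · refine Lowers.smul (fun e v hv s μ h => ?_) _
    rw [onPoly_apply, Derivation.coeFn_coe,
      MvPolynomial.coeff_pderiv, hv, zero_mul]
    rw [map_add, hvar]
    simp only [Int.ofNat_eq_natCast] at h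
    omega
  · exact absurd hn (by simp)

theorem Lowers.a {n : ℤ} (hn : 0 < n) : Lowers n (a n) :=
  Lowers.bosonMode _ (fun k => by simp [monWeight, Finsupp.weight_apply]) hn

theorem Lowers.aT {n : ℤ} (hn : 0 < n) : Lowers n (aT n) :=
  Lowers.bosonMode _ (fun k => by simp [monWeight, Finsupp.weight_apply]) hn

/-! ### Coefficients of exponentials of mode sums -/

/-- The coefficient of `z^m` in `exp (∑_{n>0} y_n z^n)`. -/
def expCoeff (y : ℕ → Op) (m : ℤ) : Op :=
  if 0 ≤ m then
    PowerSeries.coeff m.toNat (opExp (PowerSeries.mk fun n => if n = 0 then 0 else y n))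
  else 0

theorem creationExp_apply (x : ℤ → Op) (m : ℤ) (v : Fock) :
    creationExp x m v = expCoeff (fun n => x (-(n : ℤ))) m v := by
  unfold creationExp expCoeff
  split_ifs <;> rfl

theorem annihilationExp_apply (x : ℤ → Op) (m : ℤ) (v : Fock) :
    annihilationExp x m v = expCoeff (fun n => x n) (-m) v := by
  unfold annihilationExp expCoeff
  simp only [Int.neg_nonneg]
  split_ifs <;> rfl

theorem expCoeff_of_neg (y : ℕ → Op) {m : ℤ} (hm : m < 0) : expCoeff y m = 0 :=
  if_neg (by omega)

theorem expCoeff_natCast (y : ℕ → Op) (m : ℕ) :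
    expCoeff y m = ∑ k ∈ Finset.range (m + 1), ((k.factorial : ℂ)⁻¹) •
      PowerSeries.coeff m ((PowerSeries.mk fun n => if n = 0 then 0 else y n) ^ k) := by
  rw [expCoeff, if_pos (Int.natCast_nonneg m), Int.toNat_natCast, opExp, PowerSeries.coeff_mk]

theorem expCoeff_commute {T : Op} {y : ℕ → Op} (h : ∀ n, n ≠ 0 → Commute T (y n)) (m : ℤ) :
    Commute T (expCoeff y m) := by
  rcases lt_or_ge m 0 with hm | hm
  · rw [expCoeff_of_neg y hm]
    exact Commute.zero_right T
  lift m to ℕ using hm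
  rw [expCoeff_natCast]
  refine Commute.sum_right _ _ _ fun k _ => Commute.smul_right ?_ _
  -- Viewed as a constant series, `T` commutes with the exponent, hence with all of its powers.
  have hC : Commute (PowerSeries.C T) (PowerSeries.mk fun n => if n = 0 then 0 else y n) := by
    refine PowerSeries.ext fun n => ?_
    rw [PowerSeries.coeff_C_mul, PowerSeries.coeff_mul_C, PowerSeries.coeff_mk]
    split_ifs with h0
    · simp
    · exact h n h0
  have := congrArg (PowerSeries.coeff m) (hC.pow_right k).eq
  rwa [PowerSeries.coeff_C_mul, PowerSeries.coeff_mul_C] at this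

/-- This is the substitution of `c z` for `z` in the exponential. -/
theorem expCoeff_smul_pow {c : ℂ} (y : ℕ → Op) (m : ℤ) :
    expCoeff (fun n => c ^ n • y n) m = c ^ m • expCoeff y m := by
  rcases lt_or_ge m 0 with hm | hm
  · rw [expCoeff_of_neg _ hm, expCoeff_of_neg _ hm, smul_zero]
  lift m to ℕ using hm
  rw [expCoeff_natCast, expCoeff_natCast, Finset.smul_sum]
  refine Finset.sum_congr rfl fun k hk => ?_
  clear hk
  rw [smul_comm, zpow_natCast]
  congr 1
  induction k generalizing m with
  | zero =>
    rw [pow_zero, pow_zero, PowerSeries.coeff_one]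
    split_ifs with h0 <;> simp [h0]
  | succ k ih =>
    rw [pow_succ, pow_succ, PowerSeries.coeff_mul, PowerSeries.coeff_mul, Finset.smul_sum]
    refine Finset.sum_congr rfl fun p hp => ?_
    rw [Finset.HasAntidiagonal.mem_antidiagonal] at hp
    rw [ih, PowerSeries.coeff_mk, PowerSeries.coeff_mk, ← hp, pow_add]
    split_ifs
    · simp
    · rw [smul_mul_smul_comm]

/-- The coefficient is a combination of products `y_{n₁} ⋯ y_{n_k}` with `n₁ + ⋯ + n_k = m`, and
lowerings add. -/
theorem Lowers.expCoeff {y : ℕ → Op} (h : ∀ n : ℕ, n ≠ 0 → Lowers n (y n)) (m : ℤ) :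
    Lowers m (expCoeff y m) := by
  rcases lt_or_ge m 0 with hm | hm
  · rw [expCoeff_of_neg y hm]
    exact Lowers.zero m
  lift m to ℕ using hm
  rw [expCoeff_natCast]
  refine Lowers.sum fun k hk => Lowers.smul ?_ _
  clear hk
  induction k generalizing m with
  | zero =>
    rw [pow_zero, PowerSeries.coeff_one]
    split_ifs with h0
    · rw [h0]; exact Lowers.one
    · exact Lowers.zero _
  | succ k ih =>
    rw [pow_succ, PowerSeries.coeff_mul]
    refine Lowers.sum fun p hp => ?_
    rw [Finset.HasAntidiagonal.mem_antidiagonal] at hp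
    refine (ih p.1).mul (m := p.2) ?_ (by omega)
    rw [PowerSeries.coeff_mk]
    split_ifs with h0
    · exact Lowers.zero _
    · exact h _ h0

/-- This is `f₁ exp f₀` in coordinates. Terms with `i + 1 > m` vanish, so `R` may be any upper
bound, and one `R` can serve many values of `m`. -/
theorem OpJet.expCoeff {y : ℂ → ℕ → Op} {y₀ y₁ : ℕ → Op}
    (h : ∀ n, n ≠ 0 → OpJet (fun ħ => y ħ n) (y₀ n) (y₁ n))
    (hc : ∀ n n', Commute (y₀ n) (y₁ n')) {m : ℤ} {R : ℕ} (hR : m ≤ R) :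
    OpJet (fun ħ => expCoeff (y ħ) m) (expCoeff y₀ m)
      (∑ i ∈ Finset.range R, y₁ (i + 1) * QSuperVir.expCoeff y₀ (m - (i + 1 : ℕ))) := by
  rcases lt_or_ge m 0 with hm | hm
  · refine (OpJet.const 0).of_eq (fun _ => expCoeff_of_neg _ hm) (expCoeff_of_neg _ hm) ?_
    refine Finset.sum_eq_zero fun i _ => ?_
    rw [expCoeff_of_neg _ (by omega), mul_zero]
  lift m to ℕ using hm
  have hser : SeriesJet (fun ħ => PowerSeries.mk fun n => if n = 0 then 0 else y ħ n)
      (PowerSeries.mk fun n => if n = 0 then 0 else y₀ n)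
      (PowerSeries.mk fun n => if n = 0 then 0 else y₁ n) := by
    intro n
    simp only [PowerSeries.coeff_mk]
    split_ifs with h0
    · exact OpJet.const 0
    · exact h n h0
  have hcomm : Commute (PowerSeries.mk fun n => if n = 0 then 0 else y₀ n)
      (PowerSeries.mk fun n => if n = 0 then 0 else y₁ n) := by
    refine PowerSeries.ext fun n => ?_
    rw [PowerSeries.coeff_mul, PowerSeries.coeff_mul, ← Finset.Nat.sum_antidiagonal_swap]
    refine Finset.sum_congr rfl fun p _ => ?_
    simp only [PowerSeries.coeff_mk, Prod.fst_swap, Prod.snd_swap]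
    split_ifs
    · simp
    · simp
    · simp
    · exact hc _ _
  refine (hser.exp hcomm (by simp) (by simp) m).of_eq (fun ħ => by simp [QSuperVir.expCoeff])
    (by simp [QSuperVir.expCoeff]) ?_
  rw [PowerSeries.coeff_mul, Finset.Nat.sum_antidiagonal_eq_sum_range_succ_mk,
    Finset.sum_range_succ']
  simp only [PowerSeries.coeff_mk, Nat.add_one_ne_zero, if_false, if_true, zero_mul, add_zero]
  symm
  refine Finset.sum_subset_zero_on_sdiff (by intro i; simp; omega) (fun i hi => ?_) fun i hi => ?_
  · rw [expCoeff_of_neg _ (by simp at hi; omega), mul_zero]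
  · rw [Finset.mem_range] at hi
    rw [← Nat.cast_sub (by omega), QSuperVir.expCoeff, if_pos (Int.natCast_nonneg _),
      Int.toNat_natCast]

/-! ### Sums over the integers -/

section IntSums

variable {E : Type*} [AddCommGroup E]

theorem finsum_int_eq_sum_range {g : ℤ → E} {N : ℕ} (h : ∀ j, j < 0 ∨ (N : ℤ) ≤ j → g j = 0) :
    ∑ᶠ j, g j = ∑ l ∈ Finset.range N, g l := by
  rw [finsum_eq_sum_of_support_subset (s := (Finset.range N).map Nat.castEmbedding) g,
    Finset.sum_map]
  · rfl
  · intro j hj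
    by_contra hj'
    refine hj (h j ?_)
    by_contra! hlt
    refine hj' ?_
    simp only [Finset.coe_map, Set.mem_image, Finset.mem_coe, Finset.mem_range]
    exact ⟨j.toNat, by omega, Int.toNat_of_nonneg hlt.1⟩

/-- The support of `g` lies in `[0, N - i)`, so translation by `i` keeps it inside `[0, N)`. -/
theorem sum_range_shift {g : ℤ → E} {N i : ℕ} (h : ∀ j, j < 0 ∨ (N : ℤ) ≤ j + i → g j = 0) :
    ∑ l ∈ Finset.range N, g (l - i) = ∑ l ∈ Finset.range N, g l := by
  rw [← finsum_int_eq_sum_range (N := N) (g := g) fun j hj => h j (by omega),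
    ← finsum_int_eq_sum_range (N := N) (g := fun j => g (j - i)) fun j hj => h _ (by omega)]
  exact finsum_comp_equiv (Equiv.subRight (i : ℤ))

theorem finsum_int_eq_sum_symm {g : ℤ → E} {R : ℕ} (h : ∀ j : ℤ, j < -R ∨ (R : ℤ) < j → g j = 0) :
    ∑ᶠ j, g j = ∑ i ∈ Finset.range R, g (-((i + 1 : ℕ) : ℤ)) +
      (g 0 + ∑ i ∈ Finset.range R, g ((i + 1 : ℕ) : ℤ)) := by
  rw [← finsum_comp_equiv (Equiv.subRight (R : ℤ)),
    finsum_int_eq_sum_range (N := R + (R + 1)) (g := fun j => g (Equiv.subRight (R : ℤ) j))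
      fun j hj => h _ (by simp only [Equiv.subRight_apply]; omega),
    Finset.sum_range_add, ← Finset.sum_range_reflect, Finset.sum_range_succ']
  congr 1
  · refine Finset.sum_congr rfl fun i hi => ?_
    rw [Finset.mem_range] at hi
    congr 1
    simp only [Equiv.subRight_apply]
    omega
  · rw [add_comm]
    congr 1
    · simp
    · refine Finset.sum_congr rfl fun i _ => ?_
      congr 1
      simp

end IntSums

/-! ### Vertex operators as finite sums -/

/-- Coefficients of an `OpSeries` are bare functions, so vanishing at `0` is a separate hypothesis.
-/
theorem OpSeries.prod_apply {A B : OpSeries} {v : Fock} (m : ℤ) {K : Finset ℤ}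
    (hK : ∀ κ, κ ∉ K → B κ v = 0) (hA : ∀ j, A j 0 = 0) :
    A.prod B m v = ∑ κ ∈ K, A (m - κ) (B κ v) := by
  refine finsum_eq_sum_of_support_subset _ fun κ hκ => ?_
  by_contra h
  exact hκ (by simp only [hK κ h, hA])

theorem normalExp_apply {x : ℤ → Op} (hx : ∀ n, 0 < n → Lowers n (x n)) {v : Fock} {e : ℕ}
    (hv : v ∈ weightLE e) (m : ℤ) :
    normalExp x m v = ∑ l ∈ Finset.range (e + 1),
      expCoeff (fun n => x (-(n : ℤ))) (m + l) (expCoeff (fun n => x n) l v) := by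
  have hlow : ∀ l : ℤ, Lowers l (expCoeff (fun n => x n) l) := fun l =>
    Lowers.expCoeff (fun n hn => hx n (by omega)) l
  have hneg : ∀ κ : ℤ, creationExp x (m - -κ) (annihilationExp x (-κ) v) =
      expCoeff (fun n => x (-(n : ℤ))) (m + κ) (expCoeff (fun n => x n) κ v) := fun κ => by
    rw [creationExp_apply, annihilationExp_apply, neg_neg, sub_neg_eq_add]
  refine Eq.trans (finsum_comp_equiv (Equiv.neg ℤ)).symm ?_
  simp only [Equiv.neg_apply, hneg]
  refine finsum_int_eq_sum_range fun j hj => ?_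
  rcases hj with hj | hj
  · rw [expCoeff_of_neg _ hj, LinearMap.zero_apply, map_zero]
  · rw [eq_zero_of_mem_weightLE (by omega) (hlow j e v hv), map_zero]

theorem normalExp_zero (x : ℤ → Op) (m : ℤ) : normalExp x m 0 = 0 := by
  refine finsum_eq_zero_of_forall_eq_zero fun κ => ?_
  rw [annihilationExp_apply, map_zero, creationExp_apply, map_zero]

theorem normalExp_smul (x : ℤ → Op) (m : ℤ) (c : ℂ) (v : Fock) :
    normalExp x m (c • v) = c • normalExp x m v := by
  refine Eq.trans (finsum_congr fun κ => ?_) (smul_finsum c _).symm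
  rw [annihilationExp_apply, annihilationExp_apply, map_smul, creationExp_apply,
    creationExp_apply, map_smul]

theorem normalExp_rescale {c : ℂ} (hc : c ≠ 0) (x : ℤ → Op) (m : ℤ) (v : Fock) :
    normalExp (fun n => c ^ (-n) • x n) m v = c ^ m • normalExp x m v := by
  refine Eq.trans (finsum_congr fun κ => ?_) (smul_finsum _ _).symm
  rw [annihilationExp_apply, annihilationExp_apply, creationExp_apply, creationExp_apply]
  have h1 := expCoeff_smul_pow (c := c) (fun n => x (-(n : ℤ))) (m - κ)
  have h2 := expCoeff_smul_pow (c := c⁻¹) (fun n => x n) (-κ)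
  simp only [neg_neg, zpow_natCast]
  simp only [zpow_neg, zpow_natCast, inv_pow, inv_zpow, inv_inv] at h1 h2 ⊢
  rw [h1, h2, LinearMap.smul_apply, LinearMap.smul_apply, map_smul, smul_smul, ← zpow_add₀ hc,
    sub_add_cancel]

/-- The coefficient of `z^m` in the zero mode factor `e^{k χ} z^{k a_0} e^{t ã_0}`. -/
def zeroMode (k : ℤ) (t : ℂ) (m : ℤ) : Op := expChi k * powA0 1 k m * expAT0 t

/-- The vertex operator `:exp (∑_{n≠0} x_n z^{-n}): e^{k χ} z^{k a_0} e^{t ã_0}`. -/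
def vertex (k : ℤ) (x : ℤ → Op) (t : ℂ) : OpSeries :=
  (normalExp x).prod fun m v => zeroMode k t m v

theorem vertexPhi_eq (k : ℤ) : vertexPhi k = vertex k (fun n => (-((k : ℂ) / n)) • a n) 0 := by
  unfold vertexPhi vertex zeroMode
  simp only [expAT0_zero, mul_one, Module.End.mul_apply]

/-- The oscillator and zero-mode factors both undergo `z ↦ c z`, so their powers of `c` combine into
`c ^ m`. It is applied with `c = q^{∓1}`. -/
theorem prod_rescale_eq {c : ℂ} (hc : c ≠ 0) (k : ℤ) (x : ℤ → Op) (t : ℂ) (m : ℤ) (v : Fock) :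
    (normalExp fun n => c ^ (-n) • x n).prod
      (fun m v => expChi k (powA0 c k m (expAT0 t v))) m v = c ^ m • vertex k x t m v := by
  refine Eq.trans (finsum_congr fun κ => ?_) (smul_finsum _ _).symm
  beta_reduce
  rw [powA0_apply, map_smul, normalExp_smul, normalExp_rescale hc, smul_smul, ← zpow_add₀ hc,
    add_sub_cancel]
  rfl

theorem Lowers.zeroMode (k : ℤ) (t : ℂ) (m : ℤ) : Lowers 0 (zeroMode k t m) :=
  ((Lowers.expChi k).mul (Lowers.diag _) (add_zero 0)).mul (Lowers.diag _) (add_zero 0)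

theorem zeroMode_eq_zero {k : ℤ} {t : ℂ} {m : ℤ} {v : Fock}
    (h : m ∉ v.support.image fun s => k * s.1) : zeroMode k t m v = 0 := by
  rw [zeroMode, Module.End.mul_apply, Module.End.mul_apply]
  convert map_zero (expChi k)
  refine Finsupp.ext fun s => ?_
  rw [powA0, diag_apply, expAT0, diag_apply, Finsupp.zero_apply]
  by_cases hs : v s = 0
  · rw [hs, smul_zero, smul_zero]
  · rw [if_neg, zero_smul]
    rintro rfl
    exact h (Finset.mem_image.2 ⟨s, Finsupp.mem_support_iff.2 hs, rfl⟩)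

/-- Both index sets depend only on `k`, `v` and its weight bound, not on `x` or `t`. They stay fixed
as `ħ` varies. -/
theorem vertex_apply (k : ℤ) {x : ℤ → Op} (hx : ∀ n, 0 < n → Lowers n (x n)) (t : ℂ) {v : Fock}
    {e : ℕ} (hv : v ∈ weightLE e) (m : ℤ) :
    vertex k x t m v = ∑ κ ∈ v.support.image fun s => k * s.1, ∑ l ∈ Finset.range (e + 1),
      (expCoeff (fun n => x (-(n : ℤ))) (m - κ + l) *
        (expCoeff (fun n => x n) l * zeroMode k t κ)) v := by
  rw [vertex, OpSeries.prod_apply m (fun κ hκ => zeroMode_eq_zero hκ) (normalExp_zero x)]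
  refine Finset.sum_congr rfl fun κ _ => ?_
  have hZ := Lowers.zeroMode k t κ e v hv
  rw [sub_zero] at hZ
  rw [normalExp_apply hx hZ]
  rfl

theorem OpJet.zeroMode (k : ℤ) (d : ℂ) (m : ℤ) :
    OpJet (fun ħ => zeroMode k (ħ * d) m) (zeroMode k 0 m) (zeroMode k 0 m * (d • aT 0)) := by
  have hexp : OpJet (fun ħ => expAT0 (ħ * d)) (expAT0 0) (d • aT 0) := by
    intro v
    refine (Jet.sum v.support fun s _ => Jet.smul_const (fun ħ => Complex.exp (ħ * d * s.2))
      (Finsupp.single s (v s)) (by fun_prop)).of_eq (fun ħ => ?_) ?_ ?_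
    · rfl
    · change _ = ∑ s ∈ v.support, Complex.exp (0 * d * s.2) • Finsupp.single s (v s)
      simp only [zero_mul, Complex.exp_zero, one_smul, expAT0_zero]
      exact (Finsupp.sum_single v).symm
    · rw [show aT 0 = diag fun s => s.2 from rfl, LinearMap.smul_apply]
      simp only [diag, Finsupp.lsum_apply, Finsupp.sum, Finset.smul_sum]
      refine Finset.sum_congr rfl fun s _ => ?_
      rw [LinearMap.smul_apply, smul_smul, Finsupp.lsingle_apply]
      congr 1
      have hd : HasDerivAt (fun ħ : ℂ => Complex.exp (ħ * d * s.2)) (d * s.2) 0 := by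
        have h := (((hasDerivAt_id (0 : ℂ)).mul_const d).mul_const s.2).cexp
        simpa using h
      rw [hd.deriv]
  exact ((OpJet.const (expChi k * powA0 1 k m)).mul hexp).of_eq (fun _ => rfl) rfl
    (by rw [zero_mul, add_zero, QSuperVir.zeroMode, expAT0_zero, mul_one])

theorem commute_aT_zeroMode (n k m : ℤ) : Commute (aT n) (zeroMode k 0 m) := by
  rw [zeroMode, expAT0_zero, mul_one]
  exact (commute_aT_expChi n k).mul_right (commute_aT_diag n _)

theorem lowers_phi (k : ℤ) (n : ℤ) (hn : 0 < n) : Lowers n ((-((k : ℂ) / n)) • a n) :=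
  (Lowers.a hn).smul _

theorem dPhiT_prod_mulZ (A : OpSeries) (m : ℤ) (v : Fock) :
    (dPhiT.prod A).mulZ m v = ∑ᶠ i : ℤ, aT i (A (m + i) v) := by
  refine Eq.trans (finsum_comp_equiv (Equiv.addLeft m)).symm (finsum_congr fun i => ?_)
  rw [dPhiT, Equiv.coe_addLeft]
  congr 2
  ring

/-- The modes of `φ̃'(z)` applied to a vertex operator vanish outside a bounded range. -/
theorem aT_vertexPhi_eq_zero (k m : ℤ) (v : Fock) :
    ∃ R₀ : ℕ, ∀ i : ℤ, i < -R₀ ∨ (R₀ : ℤ) < i → aT i (vertexPhi k (m + i) v) = 0 := by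
  obtain ⟨e, hv⟩ := exists_mem_weightLE v
  let K := v.support.image fun s => k * s.1
  -- Below the range, every creation coefficient has negative index. Above it, `ã_i` commutes
  -- through to `v` and lowers its weight below zero.
  refine ⟨e + K.sup fun κ => (m - κ + e).toNat, fun i hi => ?_⟩
  rw [vertexPhi_eq, vertex_apply k (lowers_phi k) 0 hv, map_sum]
  refine Finset.sum_eq_zero fun κ hκ => ?_
  rw [map_sum]
  refine Finset.sum_eq_zero fun l hl => ?_
  have hle : (m - κ + e).toNat ≤ K.sup fun κ => (m - κ + e).toNat :=
    Finset.le_sup (f := fun κ => (m - κ + e).toNat) hκ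
  rw [Finset.mem_range] at hl
  push_cast at hi
  rcases hi with hi | hi
  · rw [expCoeff_of_neg _ (by omega), zero_mul, LinearMap.zero_apply, map_zero]
  · have hc : Commute (aT i) (expCoeff (fun n : ℕ => (-((k : ℂ) / (-(n : ℤ) : ℤ))) • a (-(n : ℤ)))
        (m + i - κ + l) * (expCoeff (fun n : ℕ => (-((k : ℂ) / (n : ℤ))) • a n) l *
          zeroMode k 0 κ)) :=
      (expCoeff_commute (fun n _ => ((commute_a_aT _ _).symm.smul_right _)) _).mul_right
        ((expCoeff_commute (fun n _ => ((commute_a_aT _ _).symm.smul_right _)) _).mul_right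
          (commute_aT_zeroMode _ _ _))
    rw [← Module.End.mul_apply, hc.eq, Module.End.mul_apply,
      eq_zero_of_mem_weightLE (by omega) (Lowers.aT (by omega) e v hv), map_zero]

/-! ### The first-order jet of a vertex operator -/

/-- Here `C`, `A`, `Z` are the creation, annihilation and zero-mode coefficients and `T` is `ã`. The
product rule yields negative, positive and zero modes of `T` respectively; commuting each to the
front assembles `d · zφ̃'(z)` times the vertex operator. -/
theorem sum_vertex_jet {C A Z T : ℤ → Op} {v : Fock} {e : ℕ} (K : Finset ℤ) (m : ℤ) (R : ℕ) (d : ℂ)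
    (hTC : ∀ i j, Commute (T i) (C j)) (hTA : ∀ i j, Commute (T i) (A j))
    (hTZ : ∀ i j, Commute (T i) (Z j)) (hneg : ∀ j < 0, A j = 0)
    (hlow : ∀ i j κ : ℤ, 0 < i → (e : ℤ) < j + i → T i (A j (Z κ v)) = 0) :
    ∑ κ ∈ K, ∑ l ∈ Finset.range (e + 1),
      (C (m - κ + l) * (A l * (Z κ * (d • T 0)) +
        (∑ i ∈ Finset.range R, (d • T ((i + 1 : ℕ) : ℤ)) * A (l - (i + 1 : ℕ))) * Z κ) +
        (∑ i ∈ Finset.range R, (d • T (-((i + 1 : ℕ) : ℤ))) * C (m - κ + l - (i + 1 : ℕ))) *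
          (A l * Z κ)) v =
    d • (∑ i ∈ Finset.range R, T (-((i + 1 : ℕ) : ℤ)) (∑ κ ∈ K, ∑ l ∈ Finset.range (e + 1),
        (C (m + -((i + 1 : ℕ) : ℤ) - κ + l) * (A l * Z κ)) v) +
      (T 0 (∑ κ ∈ K, ∑ l ∈ Finset.range (e + 1), (C (m + 0 - κ + l) * (A l * Z κ)) v) +
      ∑ i ∈ Finset.range R, T ((i + 1 : ℕ) : ℤ) (∑ κ ∈ K, ∑ l ∈ Finset.range (e + 1),
        (C (m + ((i + 1 : ℕ) : ℤ) - κ + l) * (A l * Z κ)) v))) := by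
  have hC : ∀ i j w, T i (C j w) = C j (T i w) := fun i j w => LinearMap.congr_fun (hTC i j).eq w
  have hA : ∀ i j w, T i (A j w) = A j (T i w) := fun i j w => LinearMap.congr_fun (hTA i j).eq w
  have hZ : ∀ i j w, T i (Z j w) = Z j (T i w) := fun i j w => LinearMap.congr_fun (hTZ i j).eq w
  simp only [map_sum, Finset.smul_sum, smul_add]
  rw [Finset.sum_comm (s := Finset.range R), Finset.sum_comm (s := Finset.range R),
    ← Finset.sum_add_distrib, ← Finset.sum_add_distrib]
  refine Finset.sum_congr rfl fun κ _ => ?_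
  simp only [LinearMap.add_apply, Module.End.mul_apply, LinearMap.sum_apply, LinearMap.smul_apply,
    map_add, map_sum, map_smul, Finset.sum_add_distrib]
  rw [add_comm]
  congr 1
  · rw [Finset.sum_comm]
    refine Finset.sum_congr rfl fun i _ => Finset.sum_congr rfl fun l _ => ?_
    congr 4
    ring
  · congr 1
    · refine Finset.sum_congr rfl fun l _ => ?_
      rw [hC, hA, hZ, add_zero]
    · rw [Finset.sum_comm]
      refine Finset.sum_congr rfl fun i _ => ?_
      -- A positive mode taken from the annihilation factor shifts its degree by `i + 1`.
      -- Re-indexing `l` transfers the shift to `C`; the boundary terms vanish by `hneg` and `hlow`.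
      have h := sum_range_shift (N := e + 1) (i := i + 1) (g := fun j =>
        d • C (m + ((i + 1 : ℕ) : ℤ) - κ + j) (T ((i + 1 : ℕ) : ℤ) (A j (Z κ v)))) fun j hj => by
          rcases hj with hj | hj
          · simp [hneg j hj]
          · rw [hlow ((i + 1 : ℕ) : ℤ) j κ (by omega) (by omega), map_zero, smul_zero]
      simp only [hC]
      rw [← h]
      refine Finset.sum_congr rfl fun l _ => ?_
      congr 3
      ring

/-- The same `d` multiplies every `ã_n`, and `e^{ħ d ã_0}` contributes the missing `n = 0` term, so
the linear part is the full field `zφ̃'(z)`. -/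
theorem Jet.vertex (k : ℤ) (d : ℂ) {x : ℂ → ℤ → Op}
    (hx : ∀ ħ n, 0 < n → Lowers n (x ħ n))
    (hj : ∀ n, n ≠ 0 → OpJet (fun ħ => x ħ n) ((-((k : ℂ) / n)) • a n) (d • aT n))
    (m : ℤ) (v : Fock) :
    Jet (fun ħ => vertex k (x ħ) (ħ * d) m v) (vertexPhi k m v)
      (d • (dPhiT.prod (vertexPhi k)).mulZ m v) := by
  obtain ⟨e, hv⟩ := exists_mem_weightLE v
  obtain ⟨R₀, hR₀⟩ := aT_vertexPhi_eq_zero k m v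
  let K := v.support.image fun s => k * s.1
  -- One bound for the modes of `φ̃'`, for the annihilation degrees `l ≤ e` and for the creation
  -- degrees `m - κ + l`.
  let R := R₀ + e + K.sup fun κ => (m - κ + e).toNat
  have hC : ∀ κ ∈ K, ∀ l ∈ Finset.range (e + 1),
      OpJet (fun ħ => expCoeff (fun n => x ħ (-(n : ℤ))) (m - κ + l)) _ _ :=
    fun κ hκ l hl => OpJet.expCoeff (R := R) (fun n hn => hj (-(n : ℤ)) (by omega))
      (fun n n' => ((commute_a_aT _ _).smul_left _).smul_right _) (by
        have : (m - κ + e).toNat ≤ K.sup fun κ => (m - κ + e).toNat :=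
          Finset.le_sup (f := fun κ => (m - κ + e).toNat) hκ
        rw [Finset.mem_range] at hl
        omega)
  have hA : ∀ l ∈ Finset.range (e + 1), OpJet (fun ħ => expCoeff (fun n => x ħ n) l) _ _ :=
    fun l hl => OpJet.expCoeff (R := R) (fun n hn => hj n (by omega))
      (fun n n' => ((commute_a_aT _ _).smul_left _).smul_right _) (by
        rw [Finset.mem_range] at hl
        omega)
  refine (Jet.sum K fun κ hκ => Jet.sum (Finset.range (e + 1)) fun l hl =>
    (hC κ hκ l hl).mul ((hA l hl).mul (OpJet.zeroMode k d κ)) v).of_eq (fun ħ => ?_) ?_ ?_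
  · exact vertex_apply k (hx ħ) _ hv m
  · rw [vertexPhi_eq]
    exact vertex_apply k (lowers_phi k) 0 hv m
  · rw [dPhiT_prod_mulZ, finsum_int_eq_sum_symm (R := R) fun j hj => hR₀ j (by omega)]
    simp only [vertexPhi_eq, vertex_apply k (lowers_phi k) 0 hv]
    symm
    refine sum_vertex_jet K m R d
      (C := expCoeff fun n : ℕ => (-((k : ℂ) / (-(n : ℤ) : ℤ))) • a (-(n : ℤ)))
      (A := expCoeff fun n : ℕ => (-((k : ℂ) / (n : ℤ))) • a n) (Z := zeroMode k 0) (T := aT)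
      (fun i j => expCoeff_commute (fun n _ => (commute_a_aT _ _).symm.smul_right _) _)
      (fun i j => expCoeff_commute (fun n _ => (commute_a_aT _ _).symm.smul_right _) _)
      (fun i j => commute_aT_zeroMode _ _ _) (fun j hj => expCoeff_of_neg _ hj)
      (fun i j κ hi hji => ?_)
    have hlow : Lowers (i + (j + 0)) (aT i *
        (expCoeff (fun n : ℕ => (-((k : ℂ) / (n : ℤ))) • a n) j * zeroMode k 0 κ)) :=
      (Lowers.aT hi).mul ((Lowers.expCoeff (fun n hn => lowers_phi k n (by omega)) j).mul
        (Lowers.zeroMode k 0 κ) rfl) rfl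
    exact eq_zero_of_mem_weightLE (by omega) (hlow e v hv)

/-! ### The deformed currents -/

theorem sgn_eq (i : Fin 2) : sgn i = 1 ∨ sgn i = -1 := by
  fin_cases i <;> simp [sgn]

theorem hasDerivAt_exp_mul (c : ℂ) : HasDerivAt (fun ħ : ℂ => Complex.exp (c * ħ)) c 0 := by
  simpa using ((hasDerivAt_id (0 : ℂ)).const_mul c).cexp

theorem zpow_exp_mul (c : ℂ) (n : ℤ) (ħ : ℂ) :
    Complex.exp (c * ħ) ^ n = Complex.exp ((n * c) * ħ) := by
  rw [← Complex.exp_int_mul, mul_assoc]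

/-- The coefficient of `ε_i a_n` in `λ_{i,n}` for `n > 0` has no term linear in `ħ`. -/
theorem lam_coeff_a_hasDerivAt (β : ℂ) (n : ℤ) :
    AnalyticAt ℂ (fun ħ => (1 + q1 ħ ^ n) * (1 + q3 β ħ ^ n) / (2 * (1 + q2 β ħ ^ (-n)))) 0 ∧
      HasDerivAt (fun ħ => (1 + q1 ħ ^ n) * (1 + q3 β ħ ^ n) / (2 * (1 + q2 β ħ ^ (-n)))) 0 0 := by
  have h1 : (fun ħ => q1 ħ ^ n) = fun ħ => Complex.exp ((n * 1) * ħ) := by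
    funext ħ; rw [← zpow_exp_mul, one_mul, q1]
  have h2 : (fun ħ => q2 β ħ ^ (-n)) = fun ħ => Complex.exp (((-n : ℤ) * (β - 1)) * ħ) := by
    funext ħ; rw [← zpow_exp_mul, q2]
  have h3 : (fun ħ => q3 β ħ ^ n) = fun ħ => Complex.exp ((n * -β) * ħ) := by
    funext ħ; rw [← zpow_exp_mul, q3]
  have hfun : (fun ħ => (1 + q1 ħ ^ n) * (1 + q3 β ħ ^ n) / (2 * (1 + q2 β ħ ^ (-n)))) = fun ħ =>
      (1 + Complex.exp ((n * 1) * ħ)) * (1 + Complex.exp ((n * -β) * ħ)) /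
        (2 * (1 + Complex.exp (((-n : ℤ) * (β - 1)) * ħ))) := by
    funext ħ
    rw [congrFun h1 ħ, congrFun h2 ħ, congrFun h3 ħ]
  rw [hfun]
  have hne : (2 : ℂ) * (1 + Complex.exp (((-n : ℤ) * (β - 1)) * 0)) ≠ 0 := by
    rw [mul_zero, Complex.exp_zero]; norm_num
  constructor
  · exact AnalyticAt.div (by fun_prop) (by fun_prop) hne
  -- At `ħ = 0` numerator and denominator both equal `4` and both have derivative `2n(1 - β)`, so
  -- the quotient has derivative `0`.
  · have h := (((hasDerivAt_exp_mul (n * 1)).const_add 1).mul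
      ((hasDerivAt_exp_mul (n * -β)).const_add 1)).div
      (((hasDerivAt_exp_mul ((-n : ℤ) * (β - 1))).const_add 1).const_mul 2) hne
    refine h.congr_deriv ?_
    simp only [mul_zero, Complex.exp_zero, Pi.mul_apply]
    push_cast
    ring

/-- For `n > 0` the slope `-nb/2` is immediate; for `n < 0` it arises as `-nβ/(2b)`, which agrees
because `b ^ 2 = β`. -/
theorem lam_jet {β b : ℂ} (hb : b ≠ 0) (hβ : b ^ 2 = β) (i : Fin 2) {n : ℤ} (hn : n ≠ 0) :
    OpJet (fun ħ => lam β b ħ i n) ((sgn i : ℂ) • a n) ((-(n * b / 2)) • aT n) := by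
  rcases lt_or_gt_of_ne hn with hneg | hpos
  · have hfun : (fun ħ => (1 - q3 β ħ ^ (-n)) / (b * (1 + q2 β ħ ^ n))) = fun ħ =>
        (1 - Complex.exp (((-n : ℤ) * -β) * ħ)) /
          (b * (1 + Complex.exp ((n * (β - 1)) * ħ))) := by
      funext ħ
      rw [← zpow_exp_mul, ← zpow_exp_mul, q2, q3]
    have hne : b * (1 + Complex.exp ((n * (β - 1)) * 0)) ≠ 0 := by
      rw [mul_zero, Complex.exp_zero]
      exact mul_ne_zero hb (by norm_num)
    have han : AnalyticAt ℂ (fun ħ => (1 - q3 β ħ ^ (-n)) / (b * (1 + q2 β ħ ^ n))) 0 := by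
      rw [hfun]
      exact AnalyticAt.div (by fun_prop) (by fun_prop) hne
    have hd : HasDerivAt (fun ħ => (1 - q3 β ħ ^ (-n)) / (b * (1 + q2 β ħ ^ n)))
        (-(n * b / 2)) 0 := by
      rw [hfun]
      have h := ((hasDerivAt_exp_mul ((-n : ℤ) * -β)).const_sub 1).div
        (((hasDerivAt_exp_mul (n * (β - 1))).const_add 1).const_mul b) hne
      refine h.congr_deriv ?_
      simp only [mul_zero, Complex.exp_zero, ← hβ]
      push_cast
      field_simp
      ring
    refine ((OpJet.const ((sgn i : ℂ) • a n)).add ((OpJet.const (aT n)).smul han)).of_eq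
      (fun ħ => ?_) ?_ ?_
    · rw [lam, if_neg (by omega), if_pos hneg]
    · simp [q3]
    · rw [hd.deriv]; simp
  · obtain ⟨han, hd⟩ := lam_coeff_a_hasDerivAt β n
    have hfun : (fun ħ => b / 2 * (1 - q1 ħ ^ n)) = fun ħ =>
        b / 2 * (1 - Complex.exp ((n * 1) * ħ)) := by
      funext ħ
      rw [← zpow_exp_mul, one_mul, q1]
    have han' : AnalyticAt ℂ (fun ħ => b / 2 * (1 - q1 ħ ^ n)) 0 := by
      rw [hfun]
      fun_prop
    have hd' : HasDerivAt (fun ħ => b / 2 * (1 - q1 ħ ^ n)) (-(n * b / 2)) 0 := by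
      rw [hfun]
      refine (((hasDerivAt_exp_mul (n * 1)).const_sub 1).const_mul (b / 2)).congr_deriv ?_
      ring
    refine (((OpJet.const ((sgn i : ℂ) • a n)).smul han).add ((OpJet.const (aT n)).smul han')).of_eq
      (fun ħ => ?_) ?_ ?_
    · rw [lam, if_pos hpos, smul_smul, mul_comm (sgn i : ℂ)]
    · simp [q1, q2, q3]
      norm_num
    · rw [hd.deriv, hd'.deriv]; simp

theorem Lowers.lam (β b ħ : ℂ) (i : Fin 2) {n : ℤ} (hn : 0 < n) : Lowers n (lam β b ħ i n) := by
  rw [QSuperVir.lam, if_pos hn]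
  exact ((Lowers.a hn).smul _).add ((Lowers.aT hn).smul _)

/-- The common first-order expansion of `Λ_i^±(z)`, where `c` is the rescaling of `z`. -/
theorem Jet.rescaled_vertex (k : ℤ) (d γ : ℂ) {x : ℂ → ℤ → Op}
    (hx : ∀ ħ n, 0 < n → Lowers n (x ħ n))
    (hj : ∀ n, n ≠ 0 → OpJet (fun ħ => x ħ n) ((-((k : ℂ) / n)) • a n) (d • aT n))
    (m : ℤ) (v : Fock) :
    Jet (fun ħ => (normalExp fun n => Complex.exp (γ * ħ) ^ (-n) • x ħ n).prod
        (fun m v => expChi k (powA0 (Complex.exp (γ * ħ)) k m (expAT0 (ħ * d) v))) m v)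
      (vertexPhi k m v)
      (d • (dPhiT.prod (vertexPhi k)).mulZ m v + (m * γ) • vertexPhi k m v) := by
  refine ((Jet.vertex k d hx hj m v).smul (g := fun ħ => Complex.exp ((m * γ) * ħ))
    (by fun_prop)).of_eq (fun ħ => ?_) ?_ ?_
  · rw [prod_rescale_eq (Complex.exp_ne_zero _), zpow_exp_mul]
  · simp
  · rw [(hasDerivAt_exp_mul (m * γ)).deriv]
    simp

theorem LambdaPlus_jet {β b : ℂ} (hb : b ≠ 0) (hβ : b ^ 2 = β) (i : Fin 2) (m : ℤ) (v : Fock) :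
    Jet (fun ħ => LambdaPlus β b ħ i m v) (vertexPhi (sgn i) m v)
      ((b / 2) • (dPhiT.prod (vertexPhi (sgn i))).mulZ m v +
        (m * ((1 - β) / 2)) • vertexPhi (sgn i) m v) := by
  -- The rescaling is `q⁻¹ = exp(((1 - β)/2) ħ)`, and `-1/n` turns the slope `-nb/2` into `b/2`.
  refine (Jet.rescaled_vertex (sgn i) (b / 2) ((1 - β) / 2)
    (x := fun ħ n => (-((1 : ℂ) / n)) • lam β b ħ i n)
    (fun ħ n hn => (Lowers.lam β b ħ i hn).smul _) (fun n hn => ?_) m v).of_eq (fun ħ => ?_) rfl rfl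
  · have hn' : (n : ℂ) ≠ 0 := Int.cast_ne_zero.2 hn
    refine ((lam_jet hb hβ i hn).smul (g := fun _ => -((1 : ℂ) / n)) analyticAt_const).of_eq
      (fun ħ => rfl) ?_ ?_
    · rw [smul_smul]; congr 1; ring
    · rw [smul_smul, deriv_const, zero_smul, add_zero]
      congr 1
      field_simp
  · have hq : Complex.exp ((1 - β) / 2 * ħ) = (q β ħ)⁻¹ := by
      rw [q, ← Complex.exp_neg]; congr 1; ring
    rw [hq, LambdaPlus]
    congr 2
    funext n
    rw [smul_smul, inv_zpow, zpow_neg, inv_inv]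
    congr 1
    ring

theorem LambdaMinus_jet {β b : ℂ} (hb : b ≠ 0) (hβ : b ^ 2 = β) (i : Fin 2) (m : ℤ) (v : Fock) :
    Jet (fun ħ => LambdaMinus β b ħ i m v) (vertexPhi (-sgn i) m v)
      ((-(b / 2)) • (dPhiT.prod (vertexPhi (-sgn i))).mulZ m v +
        (m * ((β - 1) / 2)) • vertexPhi (-sgn i) m v) := by
  refine (Jet.rescaled_vertex (-sgn i) (-(b / 2)) ((β - 1) / 2)
    (x := fun ħ n => ((1 : ℂ) / n) • lam β b ħ i n)
    (fun ħ n hn => (Lowers.lam β b ħ i hn).smul _) (fun n hn => ?_) m v).of_eq (fun ħ => ?_) rfl rfl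
  · have hn' : (n : ℂ) ≠ 0 := Int.cast_ne_zero.2 hn
    refine ((lam_jet hb hβ i hn).smul (g := fun _ => (1 : ℂ) / n) analyticAt_const).of_eq
      (fun ħ => rfl) ?_ ?_
    · rw [smul_smul]; congr 1; push_cast; ring
    · rw [smul_smul, deriv_const, zero_smul, add_zero]
      congr 1
      field_simp
  · have hq : Complex.exp ((β - 1) / 2 * ħ) = q β ħ := by
      rw [q]; congr 1; ring
    rw [hq, LambdaMinus, mul_neg]
    congr 2
    funext n
    rw [smul_smul]
    congr 1
    ring

theorem mulZ_G (s σ : ℂ) (m : ℤ) (v : Fock) :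
    (G s σ).mulZ m v = s⁻¹ • (((dPhiT.prod (vertexPhi 1)).mulZ m v -
      (dPhiT.prod (vertexPhi (-1))).mulZ m v) +
        (2 * σ * m) • (vertexPhi 1 m v - vertexPhi (-1) m v)) := by
  -- Finite support is what allows the `finsum` to be split over the two exponentials in `ψ`.
  have hfin : ∀ k : ℤ, (fun i : ℤ => aT i (vertexPhi k (m + i) v)).HasFiniteSupport := fun k => by
    obtain ⟨R, hR⟩ := aT_vertexPhi_eq_zero k m v
    refine (Set.finite_Icc (-(R : ℤ)) R).subset fun i hi => ?_
    by_contra h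
    exact hi (hR i (by rw [Set.mem_Icc] at h; omega))
  have hprod : (dPhiT.prod (psi s)).mulZ m v = s⁻¹ • ((dPhiT.prod (vertexPhi 1)).mulZ m v -
      (dPhiT.prod (vertexPhi (-1))).mulZ m v) := by
    rw [dPhiT_prod_mulZ, dPhiT_prod_mulZ, dPhiT_prod_mulZ,
      ← finsum_sub_distrib (hfin 1) (hfin (-1)), smul_finsum]
    refine finsum_congr fun i => ?_
    rw [← map_sub, ← map_smul]
    rfl
  have hderiv : (psi s).deriv.mulZ m v = (m : ℂ) • s⁻¹ • (vertexPhi 1 m v - vertexPhi (-1) m v) := by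
    rw [OpSeries.mulZ, OpSeries.deriv, sub_add_cancel]
    congr 1
    push_cast
    ring
  have hG : (G s σ).mulZ m v = (dPhiT.prod (psi s)).mulZ m v + (2 * σ) • (psi s).deriv.mulZ m v :=
    rfl
  rw [hG, hprod, hderiv]
  module

/-- Passing from `i = 0` to `i = 1` exchanges `:e^{φ}:` and `:e^{-φ}:`, which fixes their sum and
negates the linear term. The constants match since `(s b/2) s⁻¹ = b/2` and `(b/2) · 2σ = (1 - β)/2`.
-/
theorem W_jet {β b s : ℂ} (hb : b ≠ 0) (hs : s ≠ 0) (hβ : b ^ 2 = β) (i : Fin 2) (m : ℤ)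
    (v : Fock) :
    Jet (fun ħ => W β b ħ i m v) ((((Real.sqrt 2 : ℝ) : ℂ) • psiT) m v)
      ((sgn i : ℂ) • ((s * b / 2) • (G s ((1 - β) / (2 * b))).mulZ) m v) := by
  have hsqrt : ((Real.sqrt 2 : ℝ) : ℂ) ≠ 0 := by simp
  refine ((LambdaPlus_jet hb hβ i m v).add (LambdaMinus_jet hb hβ i m v)).of_eq (fun ħ => rfl) ?_ ?_
  · have h : (((Real.sqrt 2 : ℝ) : ℂ) • psiT) m v = vertexPhi 1 m v + vertexPhi (-1) m v :=
      smul_inv_smul₀ hsqrt _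
    rw [h]
    rcases sgn_eq i with hi | hi
    · rw [hi]
    · rw [hi, neg_neg, add_comm]
  · have h : ((s * b / 2) • (G s ((1 - β) / (2 * b))).mulZ) m v =
        (b / 2) • ((dPhiT.prod (vertexPhi 1)).mulZ m v - (dPhiT.prod (vertexPhi (-1))).mulZ m v) +
          (m * ((1 - β) / 2)) • (vertexPhi 1 m v - vertexPhi (-1) m v) := by
      change (s * b / 2) • (G s ((1 - β) / (2 * b))).mulZ m v = _
      rw [mulZ_G]
      match_scalars <;> field_simp
    rw [h]
    rcases sgn_eq i with hi | hi
    · rw [hi]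
      push_cast
      module
    · rw [hi, neg_neg]
      push_cast
      module

end QSuperVir

end

theorem mainTheorem6 (β : ℂ) (hβ : β ≠ 0)
    (b : ℂ) (hb : b ^ 2 = β)
    (s : ℂ) (hs : s ^ 2 = -2) :
    QSuperVir.SeriesExpansion (fun ħ => QSuperVir.W β b ħ 0)
      (((Real.sqrt 2 : ℝ) : ℂ) • QSuperVir.psiT)
      ((s * b / 2) • (QSuperVir.G s ((1 - β) / (2 * b))).mulZ) ∧
    QSuperVir.SeriesExpansion (fun ħ => QSuperVir.W β b ħ 1)
      (((Real.sqrt 2 : ℝ) : ℂ) • QSuperVir.psiT)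
      (-((s * b / 2) • (QSuperVir.G s ((1 - β) / (2 * b))).mulZ)) := by
  have hb0 : b ≠ 0 := by
    rintro rfl
    exact hβ (by rw [← hb]; norm_num)
  have hs0 : s ≠ 0 := by
    rintro rfl
    norm_num at hs
  refine ⟨fun m v => QSuperVir.Jet.hasFirstOrderExpansion ?_,
    fun m v => QSuperVir.Jet.hasFirstOrderExpansion ?_⟩
  · refine (QSuperVir.W_jet hb0 hs0 hb 0 m v).of_eq (fun _ => rfl) rfl ?_
    simp [QSuperVir.sgn]
  · refine (QSuperVir.W_jet hb0 hs0 hb 1 m v).of_eq (fun _ => rfl) rfl ?_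
    simp [QSuperVir.sgn]
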